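/- Let $N=(N_i)_{i\in I}$ be a multivariate Hawkes process with finite index set $I$ on a probability space $(\Omega,\mathcal F,\mathbb P)$: simple counting processes on $[0,\infty)$, started at $0$ and without common events, where with respect to the history of the whole process $N_i$ has intensity $$\lambda_i(t)=\mu_i+\sum_{j\in I}\int_0^t\varphi_{ij}(t-s)\,dN_j(s),$$ with $\mu_i\ge 0$ and with excitation functions $\varphi_{ij}\ge 0$ that are piecewise continuous on $(0,\infty)$ (the integral runs over the events strictly before $t$). Some subprocesses may be latent and others observed; this plays no role below. Say that the term $\int_0^t\varphi_{ij}(t-s)\,dN_j(s)$ is *positive* if with positive probability it is $>0$ at some time $t\ge 0$, and *zero* if almost surely it is $0$ at all times $t\ge 0$. The causal graph $\mathcal G$ is the directed graph on $I$ with an edge $j\to i$ if and only if $\int_0^t\varphi_{ij}(t-s)\,dN_j(s)$ is positive (cycles and self-loops are allowed). For $i\in I$ and $P\subseteq I$: - $N_i$ is *locally independent* of $(N_j)_{j\notin P}$ given $(N_j)_{j\in P}$ if $\lambda_i(t)$ depends only on the historical events of the subprocesses in $P$ (for every $t\ge0$ it agrees almost surely with a random variable measurable with respect to $\sigma(N_j(s):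 j\in P,\ s<t)$), the term $\int_0^t\varphi_{ij}(t-s)\,dN_j(s)$ is positive for every $j\in P$, and it is zero for every $j\notin P$. - $P$ is the *parent-cause set* of $i$ if $P\setminus\{i\}$ is a minimal (with respect to inclusion) set $Q\subseteq I\setminus\{i\}$ such that every directed path in $\mathcal G$ from a node $a\ne i$ to $i$ passes through some node of $Q$ (the starting node $a$ counts as a node of the path), and $i\in P$ if and only if $i$ has a self-loop in $\mathcal G$. **Proposition.** For every $i\in I$ and every $P\subseteq I$, the subprocess $N_i$ is locally independent of $(N_j)_{j\notin P}$ given $(N_j)_{j\in P}$ if and only if $P$ is the parent-cause set of $i$ in $\mathcal G$. -/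

import Mathlib

open MeasureTheory Set Filter Topology

/-! ### Counting processes -/

/-- A realization of a simple counting process on `[0, ∞)`: `c t` is the number of events up to
time `t`. It vanishes for `t ≤ 0`, is nondecreasing and right-continuous, and each jump has
size one (the left limit at `t` is at least `c t - 1`). -/
structure CountingPath where
  count : ℝ → ℕ
  eq_zero : ∀ t ≤ 0, count t = 0
  mono : Monotone count
  right_continuous : ∀ t, ContinuousWithinAt (fun s => (count s : ℝ)) (Ici t) t
  unit_jump : ∀ t, ∃ s < t, count t ≤ count s + 1

/-- The Stieltjes function of a counting path. -/
def CountingPath.stieltjes (c : CountingPath) : StieltjesFunction ℝ where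
  toFun t := (c.count t : ℝ)
  mono' _ _ h := Nat.cast_le.mpr (c.mono h)
  right_continuous' := c.right_continuous

/-- The Lebesgue-Stieltjes measure `dN(s)` of a counting path. -/
noncomputable def CountingPath.dN (c : CountingPath) : Measure ℝ := c.stieltjes.measure

/-- The event times of a counting path, that is, its jump times. -/
def CountingPath.eventTimes (c : CountingPath) : Set ℝ := {t | ∀ s < t, c.count s < c.count t}

/-- `f` is piecewise continuous on `(0, ∞)`: on every compact subinterval it has finitely many
discontinuities, and at every point it has finite one-sided limits. -/
def PiecewiseContinuousOnPos (f : ℝ → ℝ) : Prop :=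
  (∀ a b : ℝ, 0 < a → {s ∈ Icc a b | ¬ ContinuousAt f s}.Finite) ∧
  ∀ s : ℝ, 0 < s → (∃ l, Tendsto f (𝓝[<] s) (𝓝 l)) ∧ (∃ r, Tendsto f (𝓝[>] s) (𝓝 r))

/-! ### Multivariate Hawkes processes -/

/-- The term `∫₀ᵗ φ(t - s) dN(s)` along a path. It runs over the events strictly before `t`
(events occur at positive times), so only values of `φ` on `(0, ∞)` enter. -/
noncomputable def excitation (φ : ℝ → ℝ) (c : CountingPath) (t : ℝ) : ℝ :=
  ∫ s in Ioo 0 t, φ (t - s) ∂c.dN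

/-- The Hawkes intensity `λᵢ(t) = μᵢ + ∑ⱼ ∫₀ᵗ φᵢⱼ(t - s) dNⱼ(s)`. -/
noncomputable def hawkesIntensity {ι Ω : Type*} [Fintype ι] (μ : ι → ℝ) (φ : ι → ι → ℝ → ℝ)
    (N : ι → Ω → CountingPath) (i : ι) (t : ℝ) (ω : Ω) : ℝ :=
  μ i + ∑ j, excitation (φ i j) (N j ω) t

/-- The history up to time `t` of all subprocesses: the σ-algebra generated by the counts
`Nⱼ(s)`, `s ≤ t`. -/
@[reducible] def history {ι Ω : Type*} (N : ι → Ω → CountingPath) (t : ℝ) : MeasurableSpace Ω :=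
  ⨆ (j : ι) (s : ℝ) (_ : s ≤ t), MeasurableSpace.comap (fun ω => (N j ω).count s) ⊤

/-- The history strictly before time `t` of the subprocesses in `P`: the σ-algebra generated by
the counts `Nⱼ(s)`, `j ∈ P`, `s < t`. -/
@[reducible] def historyBefore {ι Ω : Type*} (N : ι → Ω → CountingPath) (P : Set ι) (t : ℝ) :
    MeasurableSpace Ω :=
  ⨆ (j : ι) (_ : j ∈ P) (s : ℝ) (_ : s < t), MeasurableSpace.comap (fun ω => (N j ω).count s) ⊤

/-- A multivariate Hawkes process on the probability space `(Ω, ℙ)`, with subprocesses indexed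
by the finite set `ι`. -/
structure MultivariateHawkesProcess (ι : Type*) [Fintype ι] {Ω : Type*} [MeasurableSpace Ω]
    (ℙ : Measure Ω) where
  /-- background intensities -/
  μ : ι → ℝ
  /-- excitation functions; `φ i j` is the effect of type-`j` events on subprocess `i` -/
  φ : ι → ι → ℝ → ℝ
  /-- the counting subprocesses -/
  N : ι → Ω → CountingPath
  μ_nonneg : ∀ i, 0 ≤ μ i
  φ_nonneg : ∀ i j s, 0 < s → 0 ≤ φ i j s
  φ_piecewise : ∀ i j, PiecewiseContinuousOnPos (φ i j)
  measurable_count : ∀ i t, Measurable fun ω => (N i ω).count t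
  /-- two different subprocesses almost surely have no common event -/
  no_common_event : ∀ᵐ ω ∂ℙ, ∀ i j, i ≠ j → Disjoint (N i ω).eventTimes (N j ω).eventTimes
  /-- `λᵢ` is the stochastic intensity of `Nᵢ` with respect to the history of the process:
  `𝔼[Nᵢ(t) - Nᵢ(s) | 𝓗ₛ] = 𝔼[∫ₛᵗ λᵢ(u) du | 𝓗ₛ]` for `0 ≤ s ≤ t`. -/
  intensity : ∀ i s t, 0 ≤ s → s ≤ t → ∀ A, MeasurableSet[history N s] A →
    ∫⁻ ω in A, (((N i ω).count t - (N i ω).count s : ℕ) : ENNReal) ∂ℙ =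
      ∫⁻ ω in A, (∫⁻ u in Ioc s t, ENNReal.ofReal (hawkesIntensity μ φ N i u ω)) ∂ℙ

namespace MultivariateHawkesProcess

variable {ι : Type*} [Fintype ι] {Ω : Type*} [MeasurableSpace Ω] {ℙ : Measure Ω}

/-- `∫₀ᵗ φᵢⱼ(t - s) dNⱼ(s)`, the contribution of past type-`j` events to `λᵢ(t)`. -/
noncomputable def contribution (H : MultivariateHawkesProcess ι ℙ) (i j : ι) (t : ℝ) (ω : Ω) :
    ℝ :=
  excitation (H.φ i j) (H.N j ω) t

/-- `∫₀ᵗ φᵢⱼ(t - s) dNⱼ(s) > 0`: with positive probability the contribution is positive at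
some time. (It cannot be positive before the first type-`j` event.) -/
def ContributionPos (H : MultivariateHawkesProcess ι ℙ) (i j : ι) : Prop :=
  0 < ℙ {ω | ∃ t : ℝ, 0 ≤ t ∧ 0 < H.contribution i j t ω}

/-- `∫₀ᵗ φᵢⱼ(t - s) dNⱼ(s) = 0`: almost surely the contribution vanishes at all times. -/
def ContributionZero (H : MultivariateHawkesProcess ι ℙ) (i j : ι) : Prop :=
  ∀ᵐ ω ∂ℙ, ∀ t : ℝ, 0 ≤ t → H.contribution i j t ω = 0

/-- `λᵢ(t)` depends only on the historical events of the subprocesses in `P`: for every `t ≥ 0`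
it agrees almost surely with a function of the history of these subprocesses before `t`. -/
def IntensityDependsOnlyOn (H : MultivariateHawkesProcess ι ℙ) (i : ι) (P : Set ι) : Prop :=
  ∀ t : ℝ, 0 ≤ t → ∃ g : Ω → ℝ, Measurable[historyBefore H.N P t] g ∧
    ∀ᵐ ω ∂ℙ, hawkesIntensity H.μ H.φ H.N i t ω = g ω

/-- `Nᵢ` is locally independent of the subprocesses outside `P` given those in `P`: the intensity
`λᵢ(t) = μᵢ + ∑ⱼ ∫₀ᵗ φᵢⱼ(t - s) dNⱼ(s)` depends only on the historical events of the
subprocesses in `P`, the term of each `j ∈ P` is positive (no member of `P` is superfluous), and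
the term of every other `j` is zero. -/
def LocallyIndependentGiven (H : MultivariateHawkesProcess ι ℙ) (i : ι) (P : Set ι) : Prop :=
  H.IntensityDependsOnlyOn i P ∧
    (∀ j ∈ P, H.ContributionPos i j) ∧ ∀ j ∉ P, H.ContributionZero i j

/-- The causal graph on the subprocesses: there is an edge from `j` to `i` iff
`∫₀ᵗ φᵢⱼ(t - s) dNⱼ(s) > 0`. Self-loops are allowed. -/
def causalGraph (H : MultivariateHawkesProcess ι ℙ) : Digraph ι where
  Adj j i := H.ContributionPos i j

end MultivariateHawkesProcess

/-! ### Directed paths and parent-cause sets -/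

/-- The list of vertices `p` is a directed path from `a` to `b`. -/
def Digraph.IsDirectedPath {V : Type*} (G : Digraph V) (a b : V) (p : List V) : Prop :=
  p.head? = some a ∧ p.getLast? = some b ∧ p.IsChain G.Adj ∧ p.Nodup

/-- `Q` does not contain `i`, and every directed path to `i` from another vertex passes through
some vertex of `Q` (possibly its starting vertex). -/
def Digraph.InterceptsPathsInto {V : Type*} (G : Digraph V) (i : V) (Q : Set V) : Prop :=
  i ∉ Q ∧ ∀ a, a ≠ i → ∀ p, G.IsDirectedPath a i p → ∃ v ∈ p, v ∈ Q

/-- `P` is the parent-cause set of `i`: its part outside `i` is a minimal set intercepting all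
directed paths into `i` from other vertices, and `i` itself belongs to `P` exactly when it has a
self-loop. -/
def Digraph.IsParentCauseSet {V : Type*} (G : Digraph V) (i : V) (P : Set V) : Prop :=
  Minimal (G.InterceptsPathsInto i) (P \ {i}) ∧ (i ∈ P ↔ G.Adj i i)

/-! ### Sets intercepting the directed paths into a vertex -/

namespace Digraph

variable {V : Type*} {G : Digraph V} {i : V}

/-! Both conditions say that `P` is the set of parents of `i`. On the graph side, a path `v → i` of
two vertices can only be intercepted at `v`, while every path into `i` from elsewhere has a parent
of `i` as its penultimate vertex. The intercepting sets are thus the sets that avoid `i` and contain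
all parents other than `i`. The least of them is the only minimal one, and the self-loop clause
settles `i` itself (`isParentCauseSet_iff`). On the process side, contributions are nonnegative, so
a term is zero exactly when it is not positive, and the last two clauses of local independence
already determine `P`. The first clause then follows: almost surely only terms from `P` remain, and
these are measurable in the history of `P` (`measurable_excitation`). -/

theorem IsDirectedPath.exists_adj_mem {a : V} {p : List V} (hp : G.IsDirectedPath a i p)
    (ha : a ≠ i) : ∃ v ∈ p, v ≠ i ∧ G.Adj v i := by
  obtain ⟨hhead, hlast, hchain, hnodup⟩ := hp
  rcases List.eq_nil_or_concat p with rfl | ⟨q, b, rfl⟩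
  · simp at hhead
  · obtain rfl : b = i := by simpa using hlast
    rcases List.eq_nil_or_concat q with rfl | ⟨r, v, rfl⟩
    · exact absurd (by simpa using hhead) (Ne.symm ha)
    · refine ⟨v, by simp, ?_, ?_⟩
      -- The path would visit `i` twice.
      · rintro rfl
        simp [List.nodup_append] at hnodup
      · simp only [List.concat_eq_append, List.append_assoc, List.isChain_append] at hchain
        simpa using hchain.2.1

theorem interceptsPathsInto_iff {Q : Set V} :
    G.InterceptsPathsInto i Q ↔ i ∉ Q ∧ {v | G.Adj v i} \ {i} ⊆ Q := by
  refine and_congr_right fun hi => ⟨?_, ?_⟩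
  · rintro h v ⟨hv, hvi⟩
    have hvi : v ≠ i := hvi
    obtain ⟨w, hw, hwQ⟩ := h v hvi [v, i] ⟨rfl, rfl, by simpa using hv, by simpa using hvi⟩
    simp only [List.mem_cons, List.not_mem_nil, or_false] at hw
    rcases hw with rfl | rfl
    · exact hwQ
    · exact absurd hwQ hi
  · intro h a ha p hp
    obtain ⟨v, hv, hvi, hadj⟩ := hp.exists_adj_mem ha
    exact ⟨v, hv, h ⟨hadj, hvi⟩⟩

theorem minimal_interceptsPathsInto_iff {Q : Set V} :
    Minimal (G.InterceptsPathsInto i) Q ↔ Q = {v | G.Adj v i} \ {i} := by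
  have hmem : G.InterceptsPathsInto i ({v | G.Adj v i} \ {i}) :=
    interceptsPathsInto_iff.2 ⟨by simp, subset_rfl⟩
  constructor
  · intro h
    have hsub := (interceptsPathsInto_iff.1 h.prop).2
    exact (h.le_of_le hmem hsub).antisymm hsub
  · rintro rfl
    exact ⟨hmem, fun R hR _ => (interceptsPathsInto_iff.1 hR).2⟩

/-- The parent-cause set of a vertex is its set of parents. -/
theorem isParentCauseSet_iff {P : Set V} : G.IsParentCauseSet i P ↔ P = {v | G.Adj v i} := by
  rw [IsParentCauseSet, minimal_interceptsPathsInto_iff]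
  constructor
  · rintro ⟨h, hi⟩
    ext v
    by_cases hv : v = i
    · subst hv
      exact hi
    · simpa [hv] using Set.ext_iff.1 h v
  · rintro rfl
    exact ⟨rfl, Iff.rfl⟩

end Digraph

/-! ### Measurability of the excitation terms -/

/-- Exhausting `(0, ∞)` by compact intervals shows that the discontinuities are countable, and
values on a countable set do not affect measurability. Nothing is known of `f` on `(-∞, 0]`, hence
the indicator. -/
theorem PiecewiseContinuousOnPos.measurable_indicator {f : ℝ → ℝ}
    (hf : PiecewiseContinuousOnPos f) : Measurable ((Ioi 0).indicator f) := by
  set D : Set ℝ := {s ∈ Ioi 0 | ¬ ContinuousAt f s} with hD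
  have hcount : D.Countable := by
    have hsub : D ⊆ ⋃ n : ℕ, {s ∈ Icc (1 / ((n : ℝ) + 1)) n | ¬ ContinuousAt f s} := by
      rintro s ⟨hs, hsc⟩
      have hs : 0 < s := hs
      obtain ⟨n, hn⟩ := exists_nat_one_div_lt hs
      obtain ⟨m, hm⟩ := exists_nat_ge s
      refine mem_iUnion.2 ⟨max n m, ⟨?_, ?_⟩, hsc⟩
      · refine le_trans ?_ hn.le
        gcongr
        exact le_max_left _ _
      · exact hm.trans (Nat.cast_le.2 (le_max_right _ _))
    exact (countable_iUnion fun n : ℕ =>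
      (hf.1 (1 / ((n : ℝ) + 1)) n (by positivity)).countable).mono hsub
  have hcont : ContinuousOn f (Ioi 0 \ D) := fun s hs => by
    have : ContinuousAt f s := by
      by_contra h
      exact hs.2 ⟨hs.1, h⟩
    exact this.continuousWithinAt
  have hmeas : Measurable ((Ioi 0 \ D).indicator f) := by
    classical
    rw [← Set.piecewise_eq_indicator]
    exact hcont.measurable_piecewise continuousOn_const
      (measurableSet_Ioi.diff hcount.measurableSet)
  refine hmeas.measurable_of_countable_ne (hcount.mono fun s hs => ?_)
  by_contra hsD
  refine hs ?_
  by_cases hs0 : s ∈ Ioi (0 : ℝ) <;> simp [Set.indicator, hs0, hsD]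

namespace CountingPath

instance (c : CountingPath) : IsLocallyFiniteMeasure c.dN :=
  inferInstanceAs (IsLocallyFiniteMeasure c.stieltjes.measure)

instance (c : CountingPath) (a b : ℝ) : IsFiniteMeasure (c.dN.restrict (Ioo a b)) :=
  isFiniteMeasure_restrict.2 measure_Ioo_lt_top.ne

theorem dN_Ioc_zero (c : CountingPath) (s : ℝ) : c.dN (Ioc 0 s) = c.count s := by
  rw [dN, StieltjesFunction.measure_Ioc]
  simp [stieltjes, c.eq_zero 0 le_rfl]

variable {Ω : Type*} [MeasurableSpace Ω] {c : Ω → CountingPath} {t : ℝ}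

theorem measurable_dN_Ioo (hc : ∀ s < t, Measurable fun ω => (c ω).count s) :
    Measurable fun ω => (c ω).dN (Ioo 0 t) := by
  -- Approaching `t` strictly from below uses only counts before `t`.
  obtain ⟨u, hu, hut, hlim⟩ := exists_seq_strictMono_tendsto t
  have hunion : Ioo 0 t = ⋃ n, Ioc 0 (u n) := by
    ext s
    simp only [mem_Ioo, mem_iUnion, mem_Ioc]
    constructor
    · rintro ⟨h0, hst⟩
      obtain ⟨n, hn⟩ := (hlim.eventually (lt_mem_nhds hst)).exists
      exact ⟨n, h0, hn.le⟩
    · rintro ⟨n, h0, hn⟩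
      exact ⟨h0, hn.trans_lt (hut n)⟩
  have hmono : Monotone fun n => Ioc 0 (u n) := fun m n hmn =>
    Ioc_subset_Ioc_right (hu.monotone hmn)
  simp only [hunion, hmono.measure_iUnion, dN_Ioc_zero]
  exact Measurable.iSup fun n => measurable_from_top.comp (hc (u n) (hut n))

/-- The events strictly before `t` form a random measure that is measurable with respect to the
counts strictly before `t`. -/
theorem measurable_dN_restrict_Ioo (hc : ∀ s < t, Measurable fun ω => (c ω).count s) :
    Measurable fun ω => (c ω).dN.restrict (Ioo 0 t) := by
  -- The restricted measures are finite, so half-lines and total mass suffice.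
  refine Measurable.measure_of_isPiSystem (S := range Iic)
    (borel_eq_generateFrom_Iic ℝ ▸ BorelSpace.measurable_eq) isPiSystem_Iic ?_ ?_
  · rintro _ ⟨s, rfl⟩
    simp only [Measure.restrict_apply measurableSet_Iic]
    rcases lt_or_ge s t with hs | hs
    · have : Iic s ∩ Ioo 0 t = Ioc 0 s := by
        ext r
        simp only [mem_inter_iff, mem_Iic, mem_Ioo, mem_Ioc]
        exact ⟨fun h => ⟨h.2.1, h.1⟩, fun h => ⟨h.2, h.1, h.2.trans_lt hs⟩⟩
      simp only [this, dN_Ioc_zero]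
      exact measurable_from_top.comp (hc s hs)
    · have : Iic s ∩ Ioo 0 t = Ioo 0 t :=
        inter_eq_right.2 fun r hr => (hr.2.trans_le hs).le
      simp only [this]
      exact measurable_dN_Ioo hc
  · simp only [Measure.restrict_apply_univ]
    exact measurable_dN_Ioo hc

end CountingPath

theorem excitation_nonneg {φ : ℝ → ℝ} (hφ : ∀ s, 0 < s → 0 ≤ φ s) (c : CountingPath) (t : ℝ) :
    0 ≤ excitation φ c t :=
  setIntegral_nonneg measurableSet_Ioo fun _ hs => hφ _ (sub_pos.2 hs.2)

theorem measurable_excitation {Ω : Type*} [MeasurableSpace Ω] {φ : ℝ → ℝ}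
    (hφ : PiecewiseContinuousOnPos φ) (hnonneg : ∀ s, 0 < s → 0 ≤ φ s) {c : Ω → CountingPath}
    {t : ℝ} (hc : ∀ s < t, Measurable fun ω => (c ω).count s) :
    Measurable fun ω => excitation φ (c ω) t := by
  -- `ψ` is measurable on all of `ℝ` and equals `φ (t - s)` for `s < t`.
  set ψ : ℝ → ℝ := fun s => (Ioi 0).indicator φ (t - s)
  have hψ : Measurable ψ := hφ.measurable_indicator.comp (measurable_const.sub measurable_id)
  have hψ0 : ∀ s, 0 ≤ ψ s := fun s => indicator_nonneg hnonneg _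
  have heq : ∀ ω, excitation φ (c ω) t =
      (∫⁻ s, ENNReal.ofReal (ψ s) ∂(c ω).dN.restrict (Ioo 0 t)).toReal := fun ω => by
    rw [← integral_eq_lintegral_of_nonneg_ae (Eventually.of_forall hψ0) hψ.aestronglyMeasurable]
    refine setIntegral_congr_fun measurableSet_Ioo fun s hs => ?_
    have : t - s ∈ Ioi (0 : ℝ) := sub_pos.2 hs.2
    simp [ψ, this]
  simp only [heq]
  exact ((Measure.measurable_lintegral hψ.ennreal_ofReal).comp
    (CountingPath.measurable_dN_restrict_Ioo hc)).ennreal_toReal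

/-! ### Local independence -/

namespace MultivariateHawkesProcess

variable {ι : Type*} [Fintype ι] {Ω : Type*} [MeasurableSpace Ω] {ℙ : Measure Ω}
  (H : MultivariateHawkesProcess ι ℙ) {i j : ι} {P : Set ι}

/-- By nonnegativity, the exceptional set of the one condition is the event of the other. -/
theorem contributionZero_iff_not_contributionPos :
    H.ContributionZero i j ↔ ¬ H.ContributionPos i j := by
  rw [ContributionPos, not_lt, nonpos_iff_eq_zero, ContributionZero, ae_iff]
  have hiff : ∀ t ω, ¬ H.contribution i j t ω = 0 ↔ 0 < H.contribution i j t ω := fun t ω =>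
    (excitation_nonneg (H.φ_nonneg i j) (H.N j ω) t).lt_iff_ne'.symm
  simp only [not_forall, hiff, exists_prop]

theorem measurable_contribution_historyBefore (hj : j ∈ P) (t : ℝ) :
    Measurable[historyBefore H.N P t] (H.contribution i j t) := by
  refine @measurable_excitation Ω (historyBefore H.N P t) _ (H.φ_piecewise i j) (H.φ_nonneg i j)
    _ _ fun s hs => ?_
  rw [measurable_iff_comap_le]
  exact le_iSup_of_le j (le_iSup_of_le hj (le_iSup_of_le s (le_iSup_of_le hs le_rfl)))

theorem intensityDependsOnlyOn_of_contributionZero (h : ∀ j ∉ P, H.ContributionZero i j) :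
    H.IntensityDependsOnlyOn i P := by
  classical
  intro t ht
  refine ⟨fun ω => H.μ i + ∑ j with j ∈ P, H.contribution i j t ω, ?_, ?_⟩
  · exact measurable_const.add (Finset.measurable_fun_sum _ fun j hj =>
      H.measurable_contribution_historyBefore (Finset.mem_filter.1 hj).2 t)
  · have hzero : ∀ᵐ ω ∂ℙ, ∀ j, j ∉ P → H.contribution i j t ω = 0 := by
      rw [ae_all_iff]
      intro j
      by_cases hj : j ∈ P
      · simp [hj]
      · filter_upwards [h j hj] with ω hω _ using hω t ht
    filter_upwards [hzero] with ω hω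
    rw [hawkesIntensity, Finset.sum_filter]
    congr 1
    refine Finset.sum_congr rfl fun j _ => ?_
    split_ifs with hj
    · rfl
    · exact hω j hj

theorem locallyIndependentGiven_iff :
    H.LocallyIndependentGiven i P ↔ P = {j | H.ContributionPos i j} := by
  constructor
  · rintro ⟨-, hpos, hzero⟩
    ext j
    refine ⟨hpos j, fun hj => ?_⟩
    by_contra hjP
    exact H.contributionZero_iff_not_contributionPos.1 (hzero j hjP) hj
  · rintro rfl
    have hzero : ∀ j ∉ {j | H.ContributionPos i j}, H.ContributionZero i j := fun j hj =>
      H.contributionZero_iff_not_contributionPos.2 hj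
    exact ⟨H.intensityDependsOnlyOn_of_contributionZero hzero, fun _ hj => hj, hzero⟩

end MultivariateHawkesProcess

theorem mainTheorem9 {ι : Type*} [Fintype ι] {Ω : Type*} [MeasurableSpace Ω]
    (ℙ : MeasureTheory.Measure Ω) [MeasureTheory.IsProbabilityMeasure ℙ]
    (H : MultivariateHawkesProcess ι ℙ) (i : ι) (P : Set ι) :
    H.LocallyIndependentGiven i P ↔ H.causalGraph.IsParentCauseSet i P :=
  H.locallyIndependentGiven_iff.trans
    (Digraph.isParentCauseSet_iff (G := H.causalGraph)).symm
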